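/- Let $K$ be a positive semidefinite $n\times n$ matrix, $p(\mathbf f)=\mathcal N(\mathbf f\mid 0,K)$ a Gaussian prior on $\mathbb R^n$, and $i$ an index with $K_{ii}>0$. For $j\ne i$ let $t_j(f_j)=\widetilde Z_j\,\mathcal N(f_j\mid\widetilde\mu_j,\widetilde\sigma_j^2)$ be Gaussian site functions with $\widetilde Z_j>0$, $\widetilde\sigma_j^2>0$. Let $q^{\setminus i}(\mathbf f)\propto p(\mathbf f)\prod_{j\ne i}t_j(f_j)$ be the cavity distribution, with Gaussian marginal $q^{\setminus i}(f_i)$, let $p(y_i\mid f_i)$ be a measurable nonnegative likelihood factor with $0<\int p(y_i\mid f_i)\,q^{\setminus i}(f_i)\,\mathrm df_i<\infty$, and let $\widetilde q(f_i)\propto q^{\setminus i}(f_i)\,p(y_i\mid f_i)$ be the tilted distribution. Let $N_{\mathrm{EP}}$ and $N_{\mathrm{QP}}$ be one-dimensional Gaussians of positive variance that minimize, among all such Gaussians $N$, respectively $\mathrm{KL}(\widetilde q\,\|\,N)$ and the squared $L_2$ Wasserstein distance $W_2^2(\widetilde q,N)$, the minima being finite. Expectation propagation (EP) and quantile propagation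 (QP) update the $i$-th site function, from the same cavity distribution, to $t_{\mathrm{EP}}(f_i)\propto N_{\mathrm{EP}}(f_i)/q^{\setminus i}(f_i)$ and $t_{\mathrm{QP}}(f_i)\propto N_{\mathrm{QP}}(f_i)/q^{\setminus i}(f_i)$, respectively. Then: 1. If $t_{\mathrm{EP}}$ is a Gaussian site function, that is, a positive multiple of a Gaussian density with a variance $\widetilde\sigma_{\mathrm{EP}}^2>0$, then $t_{\mathrm{QP}}$ is also a positive multiple of a Gaussian density, with a variance $\widetilde\sigma_{\mathrm{QP}}^2>0$, and $\widetilde\sigma_{\mathrm{QP}}^2\le\widetilde\sigma_{\mathrm{EP}}^2$. 2. The approximate posteriors $q_{\mathrm{EP}}(\mathbf f)\propto p(\mathbf f)\,t_{\mathrm{EP}}(f_i)\prod_{j\ne i}t_j(f_j)$ and $q_{\mathrm{QP}}(\mathbf f)\propto p(\mathbf f)\,t_{\mathrm{QP}}(f_i)\prod_{j\ne i}t_j(f_j)$ have Gaussian marginals in $f_i$, and their variances satisfy $\sigma_{q,\mathrm{QP}}^2\le\sigma_{q,\mathrm{EP}}^2$. -/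

import Mathlib

open MeasureTheory ProbabilityTheory Set
open scoped ENNReal NNReal

noncomputable section

namespace GPApprox

/-- The probability measure proportional to `ρ` (meaningful when the mass of `ρ` is neither
zero nor infinite): this is what `∝` means between probability distributions. -/
def normalize {α : Type*} [MeasurableSpace α] (ρ : Measure α) : Measure α :=
  (ρ univ)⁻¹ • ρ

/-- `t` is a Gaussian site function `t(f) = Z * N(f | m, v)` with scale `Z > 0`, mean `m` and
variance `v > 0`. -/
def IsGaussianSite (t : ℝ → ℝ) (m : ℝ) (v : ℝ≥0) : Prop :=
  v ≠ 0 ∧ ∃ Z : ℝ, 0 < Z ∧ ∀ f : ℝ, t f = Z * gaussianPDFReal m v f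

/-- The approximate posterior `q(f) ∝ p(f) ∏ j, t_j(f_j)`, with Gaussian prior
`p(f) = N(f | 0, K)`. -/
def approxPosterior {n : ℕ} (K : Matrix (Fin n) (Fin n) ℝ) (t : Fin n → ℝ → ℝ) :
    Measure (EuclideanSpace ℝ (Fin n)) :=
  normalize ((multivariateGaussian 0 K).withDensity
    fun f => ENNReal.ofReal (∏ j, t j (f j)))

/-- The cavity distribution `q^{∖i}(f) ∝ p(f) ∏ j ≠ i, t_j(f_j)`. -/
def cavity {n : ℕ} (K : Matrix (Fin n) (Fin n) ℝ) (t : Fin n → ℝ → ℝ) (i : Fin n) :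
    Measure (EuclideanSpace ℝ (Fin n)) :=
  normalize ((multivariateGaussian 0 K).withDensity
    fun f => ENNReal.ofReal (∏ j ∈ Finset.univ.erase i, t j (f j)))

/-- The marginal distribution of the coordinate `f_i`. -/
def marginal {n : ℕ} (q : Measure (EuclideanSpace ℝ (Fin n))) (i : Fin n) : Measure ℝ :=
  q.map fun f => f i

/-- The univariate tilted distribution `q̃(f) ∝ c(f) ℓ(f)` of a cavity marginal `c` and a
likelihood `ℓ`, where `ℓ(f) = p(y_i | f)` for the observed output `y_i`. -/
def tilted (c : Measure ℝ) (l : ℝ → ℝ) : Measure ℝ :=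
  normalize (c.withDensity fun f => ENNReal.ofReal (l f))

/-- The squared `L₂` Wasserstein distance on the real line: the infimum of the transport cost
`∫ |x - z|² dπ(x, z)` over the measures `π` with marginals `ξ` and `ν`. -/
def wassersteinSq (ξ ν : Measure ℝ) : ℝ≥0∞ :=
  ⨅ π ∈ {π : Measure (ℝ × ℝ) | π.map Prod.fst = ξ ∧ π.map Prod.snd = ν},
    ∫⁻ p, ENNReal.ofReal (|p.1 - p.2| ^ 2) ∂π

/-- `N(m, v)` minimizes the divergence `D` over the Gaussians of positive variance, the minimum
being finite. -/
def IsGaussianArgmin (D : Measure ℝ → ℝ≥0∞) (m : ℝ) (v : ℝ≥0) : Prop :=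
  v ≠ 0 ∧ D (gaussianReal m v) ≠ ∞ ∧
    ∀ (m' : ℝ) (v' : ℝ≥0), v' ≠ 0 → D (gaussianReal m v) ≤ D (gaussianReal m' v')

/-- EP projection: `N(m, v)` is a minimizer of `KL(q̃ ‖ N)`. -/
def IsKLProjection (ρ : Measure ℝ) (m : ℝ) (v : ℝ≥0) : Prop :=
  IsGaussianArgmin (fun ν => InformationTheory.klDiv ρ ν) m v

/-- QP projection: `N(m, v)` is a minimizer of `W₂²(q̃, N)`. -/
def IsW2Projection (ρ : Measure ℝ) (m : ℝ) (v : ℝ≥0) : Prop :=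
  IsGaussianArgmin (fun ν => wassersteinSq ρ ν) m v

/-- `t` is a site function updated from the projected Gaussian `N(m, v)`:
`t(f) ∝ N(f | m, v) / q^{∖i}(f)`, where the Gaussian cavity marginal `c` enters through the
Gaussian density with its mean and its variance. -/
def IsSiteUpdate (c : Measure ℝ) (m : ℝ) (v : ℝ≥0) (t : ℝ → ℝ) : Prop :=
  ∃ a : ℝ, 0 < a ∧ ∀ f : ℝ,
    t f = a * (gaussianPDFReal m v f /
      gaussianPDFReal (∫ x, x ∂c) (variance id c).toNNReal f)

end GPApprox

end

/-! Both claims reduce to one scalar inequality: the projected variances satisfy `vQP ≤ vEP`.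

With `V` the variance of the tilted law, minimizing the KL divergence matches moments, so `vEP = V`
(`IsKLProjection.variance_eq`). A Wasserstein projection cannot have variance above `V`
(`IsW2Projection.le_variance`): otherwise, contracting the Gaussian coordinate of any coupling and
recentring it lowers the cost by an amount independent of the coupling, hence lowers the infimum.
Neither optimal couplings nor quantile functions are needed.

The cavity marginal is a nondegenerate Gaussian of variance `u` (`exists_cavity_eq`). Dividing a
Gaussian density of variance `v` by it leaves precision `v⁻¹ - u⁻¹` (`isGaussianSite_update_iff`),
so a smaller projected variance gives a larger site precision. Multiplying the cavity by the new
site restores the projection as marginal (`marginal_approxPosterior_update`), so the posterior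
variances are `vEP` and `vQP` themselves. -/

namespace GPApprox

/-! ### Normalization, push-forward and densities. -/

section Normalize

variable {α β : Type*} [MeasurableSpace α] [MeasurableSpace β]

lemma normalize_smul (ρ : Measure α) {C : ℝ≥0∞} (hC0 : C ≠ 0) (hC : C ≠ ∞) :
    normalize (C • ρ) = normalize ρ := by
  simp only [normalize, Measure.smul_apply, smul_eq_mul, smul_smul]
  rw [ENNReal.mul_inv (Or.inl hC0) (Or.inl hC), mul_comm C⁻¹, mul_assoc,
    ENNReal.inv_mul_cancel hC0 hC, mul_one]

lemma normalize_eq_self (ρ : Measure α) [IsProbabilityMeasure ρ] : normalize ρ = ρ := by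
  simp [normalize]

lemma isProbabilityMeasure_normalize {ρ : Measure α} (h0 : ρ univ ≠ 0) (h : ρ univ ≠ ∞) :
    IsProbabilityMeasure (normalize ρ) :=
  ⟨by simp [normalize, ENNReal.inv_mul_cancel h0 h]⟩

lemma normalize_absolutelyContinuous (ρ : Measure α) : normalize ρ ≪ ρ :=
  Measure.smul_absolutelyContinuous

lemma map_normalize (ρ : Measure α) {f : α → β} (hf : Measurable f) :
    (normalize ρ).map f = normalize (ρ.map f) := by
  simp [normalize, Measure.map_smul, Measure.map_apply hf MeasurableSet.univ]

lemma map_withDensity_comp (ρ : Measure α) {f : α → β} (hf : Measurable f) {g : β → ℝ≥0∞}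
    (hg : Measurable g) :
    (ρ.withDensity fun x => g (f x)).map f = (ρ.map f).withDensity g := by
  ext s hs
  rw [Measure.map_apply hf hs, withDensity_apply _ (hf hs), withDensity_apply _ hs,
    Measure.restrict_map hf hs, lintegral_map hg hf]

end Normalize

/-! ### Products and quotients of one-dimensional Gaussian densities. -/

section RealGaussian

/-- In natural parameters, products and quotients of densities become sums and differences of the
coefficients `m * v⁻¹` and `v⁻¹`. -/
lemma gaussianPDFReal_eq_mul_exp (m : ℝ) (v : ℝ≥0) (x : ℝ) :
    gaussianPDFReal m v x =
      gaussianPDFReal m v 0 * Real.exp (m * (v : ℝ)⁻¹ * x - (v : ℝ)⁻¹ / 2 * x ^ 2) := by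
  simp only [gaussianPDFReal, mul_assoc, ← Real.exp_add]
  congr 3
  rcases eq_or_ne v 0 with rfl | hv
  · simp
  · have : (v : ℝ) ≠ 0 := by exact_mod_cast hv
    field_simp
    ring

lemma log_gaussianPDFReal (m : ℝ) {v : ℝ≥0} (hv : v ≠ 0) (x : ℝ) :
    Real.log (gaussianPDFReal m v x) =
      -(Real.log (2 * Real.pi) / 2) - Real.log v / 2 - (x - m) ^ 2 / (2 * v) := by
  have hv' : (0 : ℝ) < v := by exact_mod_cast pos_iff_ne_zero.mpr hv
  have h2 : 0 < 2 * Real.pi := by positivity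
  rw [gaussianPDFReal, Real.log_mul (by positivity) (Real.exp_ne_zero _), Real.log_inv,
    Real.log_sqrt (by positivity), Real.log_exp, Real.log_mul h2.ne' hv'.ne']
  ring

/-- Up to a positive factor, the product of two Gaussian densities is a Gaussian density whose
precision is the sum of the two precisions. -/
lemma exists_gaussianPDFReal_mul (a m : ℝ) {u v : ℝ≥0} (hu : u ≠ 0) (hv : v ≠ 0) :
    ∃ (Z b : ℝ) (s : ℝ≥0), 0 < Z ∧ s ≠ 0 ∧ ∀ x,
      gaussianPDFReal a u x * gaussianPDFReal m v x = Z * gaussianPDFReal b s x := by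
  have hu' : (u : ℝ) ≠ 0 := by exact_mod_cast hu
  have hv' : (v : ℝ) ≠ 0 := by exact_mod_cast hv
  have hs : (u⁻¹ + v⁻¹)⁻¹ ≠ 0 := by positivity
  set s : ℝ≥0 := (u⁻¹ + v⁻¹)⁻¹ with hsdef
  have hs' : (s : ℝ)⁻¹ = (u : ℝ)⁻¹ + (v : ℝ)⁻¹ := by simp [hsdef]
  have hs0 : (s : ℝ) ≠ 0 := by exact_mod_cast hs
  set b : ℝ := s * (a * (u : ℝ)⁻¹ + m * (v : ℝ)⁻¹) with hb
  have hbs : b * (s : ℝ)⁻¹ = a * (u : ℝ)⁻¹ + m * (v : ℝ)⁻¹ := by rw [hb]; field_simp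
  have h0 := gaussianPDFReal_pos b s 0 hs
  refine ⟨gaussianPDFReal a u 0 * gaussianPDFReal m v 0 / gaussianPDFReal b s 0, b, s,
    div_pos (mul_pos (gaussianPDFReal_pos a u 0 hu) (gaussianPDFReal_pos m v 0 hv)) h0, hs,
    fun x => ?_⟩
  rw [gaussianPDFReal_eq_mul_exp a, gaussianPDFReal_eq_mul_exp m, gaussianPDFReal_eq_mul_exp b s x,
    hbs, hs', mul_mul_mul_comm, ← Real.exp_add, ← mul_assoc, div_mul_cancel₀ _ h0.ne']
  congr 2
  ring

lemma gaussianReal_withDensity_gaussianPDF (a m : ℝ) {u v : ℝ≥0} (hu : u ≠ 0) (hv : v ≠ 0) :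
    ∃ (C : ℝ≥0∞) (b : ℝ) (s : ℝ≥0), C ≠ 0 ∧ C ≠ ∞ ∧ s ≠ 0 ∧
      (gaussianReal a u).withDensity (gaussianPDF m v) = C • gaussianReal b s := by
  obtain ⟨Z, b, s, hZ, hs, h⟩ := exists_gaussianPDFReal_mul a m hu hv
  refine ⟨ENNReal.ofReal Z, b, s, by simpa using hZ, ENNReal.ofReal_ne_top, hs, ?_⟩
  rw [gaussianReal_of_var_ne_zero _ hu, gaussianReal_of_var_ne_zero _ hs,
    ← withDensity_mul _ (measurable_gaussianPDF _ _) (measurable_gaussianPDF _ _),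
    ← withDensity_smul _ (measurable_gaussianPDF _ _)]
  congr 1
  ext x
  simp only [Pi.mul_apply, Pi.smul_apply, gaussianPDF, smul_eq_mul]
  rw [← ENNReal.ofReal_mul (gaussianPDFReal_nonneg _ _ _), h, ENNReal.ofReal_mul hZ.le]

/-- The cavity density cancels, so reweighting by an updated site returns the projected Gaussian. -/
lemma gaussianReal_withDensity_div (a m : ℝ) {u v : ℝ≥0} (hu : u ≠ 0) (hv : v ≠ 0) {k : ℝ}
    (hk : 0 < k) :
    (gaussianReal a u).withDensity
        (fun x => ENNReal.ofReal (k * (gaussianPDFReal m v x / gaussianPDFReal a u x))) =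
      ENNReal.ofReal k • gaussianReal m v := by
  rw [gaussianReal_of_var_ne_zero _ hu, gaussianReal_of_var_ne_zero _ hv,
    ← withDensity_mul _ (measurable_gaussianPDF _ _) (by fun_prop),
    ← withDensity_smul _ (measurable_gaussianPDF _ _)]
  congr 1
  ext x
  have hx := gaussianPDFReal_pos a u x hu
  simp only [Pi.mul_apply, Pi.smul_apply, gaussianPDF, smul_eq_mul]
  rw [← ENNReal.ofReal_mul hx.le, ← ENNReal.ofReal_mul hk.le]
  congr 1
  field_simp

/-- The quotient of two Gaussian densities determines, and is a Gaussian site for, the difference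
of the precisions whenever that difference is positive. -/
lemma isGaussianSite_update_iff {a m k : ℝ} {u v : ℝ≥0} (hu : u ≠ 0) (hv : v ≠ 0) (hk : 0 < k)
    {t : ℝ → ℝ} (ht : ∀ f, t f = k * (gaussianPDFReal m v f / gaussianPDFReal a u f)) (s : ℝ≥0) :
    (∃ b, IsGaussianSite t b s) ↔ s ≠ 0 ∧ (s : ℝ)⁻¹ = (v : ℝ)⁻¹ - (u : ℝ)⁻¹ := by
  have hc : 0 < gaussianPDFReal m v 0 / gaussianPDFReal a u 0 :=
    div_pos (gaussianPDFReal_pos m v 0 hv) (gaussianPDFReal_pos a u 0 hu)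
  have ht' : ∀ f, t f = k * (gaussianPDFReal m v 0 / gaussianPDFReal a u 0) *
      Real.exp ((m * (v : ℝ)⁻¹ - a * (u : ℝ)⁻¹) * f
        - ((v : ℝ)⁻¹ - (u : ℝ)⁻¹) / 2 * f ^ 2) := by
    intro f
    rw [ht, gaussianPDFReal_eq_mul_exp m, gaussianPDFReal_eq_mul_exp a, mul_div_mul_comm,
      ← Real.exp_sub, ← mul_assoc]
    congr 2
    ring
  constructor
  · rintro ⟨b, hs, Z, hZ, h⟩
    refine ⟨hs, ?_⟩
    have hZ' : 0 < Z * gaussianPDFReal b s 0 := mul_pos hZ (gaussianPDFReal_pos b s 0 hs)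
    have key : ∀ f : ℝ, Real.log (k * (gaussianPDFReal m v 0 / gaussianPDFReal a u 0)) +
        ((m * (v : ℝ)⁻¹ - a * (u : ℝ)⁻¹) * f - ((v : ℝ)⁻¹ - (u : ℝ)⁻¹) / 2 * f ^ 2) =
        Real.log (Z * gaussianPDFReal b s 0) + (b * (s : ℝ)⁻¹ * f - (s : ℝ)⁻¹ / 2 * f ^ 2) := by
      intro f
      have h1 := h f
      rw [ht', gaussianPDFReal_eq_mul_exp b, ← mul_assoc] at h1
      have h2 := congrArg Real.log h1
      rwa [Real.log_mul (mul_pos hk hc).ne' (Real.exp_ne_zero _),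
        Real.log_mul hZ'.ne' (Real.exp_ne_zero _), Real.log_exp, Real.log_exp] at h2
    -- The second difference at `-1, 0, 1` isolates the quadratic coefficient, which is half the
    -- precision.
    linarith [key 0, key 1, key (-1)]
  · rintro ⟨hs, h⟩
    have hs0 : (s : ℝ) ≠ 0 := by exact_mod_cast hs
    set b : ℝ := s * (m * (v : ℝ)⁻¹ - a * (u : ℝ)⁻¹) with hb
    have hbs : b * (s : ℝ)⁻¹ = m * (v : ℝ)⁻¹ - a * (u : ℝ)⁻¹ := by rw [hb]; field_simp
    have h0 := gaussianPDFReal_pos b s 0 hs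
    refine ⟨b, hs, k * (gaussianPDFReal m v 0 / gaussianPDFReal a u 0) / gaussianPDFReal b s 0,
      div_pos (mul_pos hk hc) h0, fun f => ?_⟩
    rw [ht', gaussianPDFReal_eq_mul_exp b s f, hbs, h, ← mul_assoc, div_mul_cancel₀ _ h0.ne']

end RealGaussian

/-! ### Gaussian measures reweighted along a linear form. -/

section Conditioning

variable {E : Type*} [NormedAddCommGroup E] [InnerProductSpace ℝ E] [CompleteSpace E]
  [SecondCountableTopology E] [MeasurableSpace E] [BorelSpace E]

/-- Gaussian regression: under a Gaussian measure, `x` minus a suitable multiple of the linear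
form `⟪l, x⟫` is independent of that form. -/
lemma exists_indepFun_inner (P : Measure E) [IsGaussian P] (l : E)
    (hl : Var[fun x => inner ℝ l x; P] ≠ 0) :
    ∃ w : E, IndepFun (fun x : E => x - inner ℝ l x • w) (fun x => inner ℝ l x) P := by
  set τ : ℝ := Var[fun x => inner ℝ l x; P] with hτ
  have hmem : ∀ u : E, MemLp (fun x => inner ℝ u x) 2 P := fun u =>
    IsGaussian.memLp_dual P (innerSL ℝ u) 2 (by simp)
  -- The regression vector: the Riesz representative of the covariance with `⟪l, ·⟫`, divided by the
  -- variance. It makes the residual uncorrelated with the form, and joint Gaussianity upgrades this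
  -- to independence.
  set w : E := τ⁻¹ • (InnerProductSpace.toDual ℝ E).symm (covarianceBilin P l) with hw
  have hwu : ∀ u : E, inner ℝ u w = τ⁻¹ * cov[fun x => inner ℝ l x, fun x => inner ℝ u x; P] := by
    intro u
    rw [hw, inner_smul_right, real_inner_comm, InnerProductSpace.toDual_symm_apply,
      covarianceBilin_apply_eq_cov IsGaussian.memLp_two_id]
  refine ⟨w, ?_⟩
  let A : E →L[ℝ] E × ℝ :=
    (ContinuousLinearMap.id ℝ E - (innerSL ℝ l).smulRight w).prod (innerSL ℝ l)
  have hG : HasGaussianLaw (fun x : E => (x - inner ℝ l x • w, inner ℝ l x)) P :=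
    (IsGaussian.hasGaussianLaw_id (μ := P)).map_fun A
  refine hG.indepFun_of_covariance_inner fun u r => ?_
  have h1 : (fun x : E => inner ℝ u (x - inner ℝ l x • w)) =
      fun x => inner ℝ u x - inner ℝ u w * inner ℝ l x := by
    ext x
    rw [inner_sub_right, inner_smul_right, mul_comm]
  have h2 : (fun x : E => inner ℝ r (inner ℝ l x)) = fun x : E => r * inner ℝ l x := by
    ext x
    simp [mul_comm]
  rw [h1, h2, covariance_const_mul_right,
    covariance_fun_sub_left (hmem u) ((hmem l).const_mul _) (hmem l),
    covariance_const_mul_left, covariance_self (by fun_prop), ← hτ, hwu, covariance_comm]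
  field_simp
  ring

/-- A Gaussian measure weighted by a Gaussian function of a linear form is a multiple of a Gaussian
measure, and the weight leaves no direction with positive variance degenerate. -/
lemma exists_isGaussian_withDensity (P : Measure E) [IsGaussian P] (l : E) (m : ℝ) {v : ℝ≥0}
    (hv : v ≠ 0) :
    ∃ (C : ℝ≥0∞) (Q : Measure E), C ≠ 0 ∧ C ≠ ∞ ∧ IsGaussian Q ∧
      P.withDensity (fun x => gaussianPDF m v (inner ℝ l x)) = C • Q ∧
      ∀ u : E, Var[fun x => inner ℝ u x; P] ≠ 0 → Var[fun x => inner ℝ u x; Q] ≠ 0 := by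
  have hmem : ∀ u : E, MemLp (fun x => inner ℝ u x) 2 P := fun u =>
    IsGaussian.memLp_dual P (innerSL ℝ u) 2 (by simp)
  -- In the degenerate case the form is almost surely constant, so the weight is a constant factor.
  by_cases hl : Var[fun x => inner ℝ l x; P] = 0
  · refine ⟨gaussianPDF m v (∫ x, inner ℝ l x ∂P), P, (gaussianPDF_pos m hv _).ne',
      gaussianPDF_ne_top, inferInstance, ?_, fun u hu => hu⟩
    rw [← withDensity_const]
    refine withDensity_congr_ae ?_
    have : evariance (fun x => inner ℝ l x) P = 0 := by
      rw [← (hmem l).ofReal_variance_eq, hl, ENNReal.ofReal_zero]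
    filter_upwards [(evariance_eq_zero_iff (by fun_prop)).1 this] with x hx
    rw [hx]
  obtain ⟨w, hind⟩ := exists_indepFun_inner P l hl
  set Y : E → E := fun x => x - inner ℝ l x • w with hY
  set Z : E → ℝ := fun x => inner ℝ l x with hZ
  have hYm : Measurable Y := by fun_prop
  have hZm : Measurable Z := by fun_prop
  let A : E × ℝ →L[ℝ] E :=
    ContinuousLinearMap.fst ℝ E ℝ + (ContinuousLinearMap.snd ℝ E ℝ).smulRight w
  have hA : ∀ x, A (Y x, Z x) = x := fun x => by simp [A, hY, hZ]
  have hYG : IsGaussian (P.map Y) :=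
    isGaussian_map (μ := P) (ContinuousLinearMap.id ℝ E - (innerSL ℝ l).smulRight w)
  have hZG : P.map Z = gaussianReal (∫ x, inner ℝ l x ∂P) (Var[Z; P]).toNNReal :=
    IsGaussian.map_eq_gaussianReal (innerSL ℝ l)
  have hτ : (Var[Z; P]).toNNReal ≠ 0 := by
    rw [Ne, Real.toNNReal_eq_zero, not_le]
    exact lt_of_le_of_ne (variance_nonneg _ _) (Ne.symm hl)
  obtain ⟨C, b, s, hC0, hC, hs, hCs⟩ :=
    gaussianReal_withDensity_gaussianPDF (∫ x, inner ℝ l x ∂P) m hτ hv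
  have hprod : P.map (fun x => (Y x, Z x)) = (P.map Y).prod (P.map Z) :=
    hind.map_prod_eq_prod_map_map hYm.aemeasurable hZm.aemeasurable
  -- The weight sees only `Z`, which is independent of `Y`: only the second factor of the product
  -- law changes, and `A` reassembles `x` from the pair.
  have hQ : P.withDensity (fun x => gaussianPDF m v (Z x)) =
      C • ((P.map Y).prod (gaussianReal b s)).map A := by
    have h1 : (P.withDensity (fun x => gaussianPDF m v (Z x))).map (fun x => (Y x, Z x)) =
        C • (P.map Y).prod (gaussianReal b s) := by
      have := map_withDensity_comp P (hYm.prodMk hZm)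
        (g := fun p : E × ℝ => gaussianPDF m v p.2)
        ((measurable_gaussianPDF m v).comp measurable_snd)
      simp only at this
      rw [this, hprod, ← prod_withDensity_right (measurable_gaussianPDF m v), hZG, hCs,
        Measure.prod_smul_right]
    rw [← Measure.map_smul, ← h1, Measure.map_map (by fun_prop) (hYm.prodMk hZm)]
    have : (A ∘ fun x => (Y x, Z x)) = id := funext hA
    rw [this, Measure.map_id]
  -- the variance of a linear form splits along the regression
  have hvar : ∀ (ν : Measure ℝ) [IsGaussian ν] (u : E),
      Var[fun x => inner ℝ u x; ((P.map Y).prod ν).map A] =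
        Var[fun x => inner ℝ u x; P.map Y] + (inner ℝ u w) ^ 2 * Var[id; ν] := by
    intro ν _ u
    rw [variance_map (by fun_prop) (by fun_prop)]
    have h1 : ((fun x => inner ℝ u x) ∘ A) =
        fun p : E × ℝ => inner ℝ u p.1 + inner ℝ u w * id p.2 := by
      ext p
      simp [A, inner_add_right, inner_smul_right, mul_comm]
    have h2 : MemLp (fun x => inner ℝ u x) 2 (P.map Y) :=
      IsGaussian.memLp_dual (P.map Y) (innerSL ℝ u) 2 (by simp)
    have h3 : MemLp (fun z : ℝ => inner ℝ u w * id z) 2 ν :=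
      (IsGaussian.memLp_two_id (μ := ν)).const_mul _
    rw [h1, variance_add_prod h2 h3, variance_const_mul]
  refine ⟨C, ((P.map Y).prod (gaussianReal b s)).map A, hC0, hC, inferInstance, hQ,
    fun u hu h => hu ?_⟩
  have hP : P = ((P.map Y).prod (P.map Z)).map A := by
    rw [← hprod, Measure.map_map (by fun_prop) (hYm.prodMk hZm)]
    have : (A ∘ fun x => (Y x, Z x)) = id := funext hA
    rw [this, Measure.map_id]
  have hZG' : IsGaussian (P.map Z) := by rw [hZG]; infer_instance
  have hP' := hvar (P.map Z) u
  rw [← hP] at hP'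
  rw [hvar, variance_id_gaussianReal] at h
  have hs' : (s : ℝ) ≠ 0 := by exact_mod_cast hs
  have h1 := variance_nonneg (fun x => inner ℝ u x) (P.map Y)
  have h2 : 0 ≤ (inner ℝ u w) ^ 2 * (s : ℝ) := by positivity
  -- Zero variance under the new measure kills both nonnegative terms. Since `s ≠ 0`, this forces
  -- `⟪u, w⟫ = 0`, and the variance under `P` vanishes as well.
  have h3 : (inner ℝ u w) ^ 2 * (s : ℝ) = 0 := by linarith
  have h4 : (inner ℝ u w) ^ 2 = 0 := (mul_eq_zero.1 h3).resolve_right hs'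
  rw [hP', h4]
  linarith

end Conditioning

/-! ### Gaussian sites, the cavity and the updated posterior. -/

lemma IsGaussianSite.measurable {t : ℝ → ℝ} {m : ℝ} {v : ℝ≥0} (h : IsGaussianSite t m v) :
    Measurable t := by
  obtain ⟨-, Z, -, hZ⟩ := h
  rw [funext hZ]
  exact (measurable_gaussianPDFReal m v).const_mul Z

lemma IsGaussianSite.nonneg {t : ℝ → ℝ} {m : ℝ} {v : ℝ≥0} (h : IsGaussianSite t m v) (f : ℝ) :
    0 ≤ t f := by
  obtain ⟨-, Z, hZ0, hZ⟩ := h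
  rw [hZ]
  exact mul_nonneg hZ0.le (gaussianPDFReal_nonneg m v f)

/-- Sites are absorbed one at a time. Nondegeneracy of coordinate `i` is carried through the
induction because the cavity marginal must have a density to divide by. -/
lemma exists_isGaussian_withDensity_prod {n : ℕ} (P : Measure (EuclideanSpace ℝ (Fin n)))
    [IsGaussian P] (t : Fin n → ℝ → ℝ) (i : Fin n) (hi : Var[fun f => f i; P] ≠ 0)
    (s : Finset (Fin n)) (ht : ∀ j ∈ s, ∃ (m : ℝ) (v : ℝ≥0), IsGaussianSite (t j) m v) :
    ∃ (C : ℝ≥0∞) (Q : Measure (EuclideanSpace ℝ (Fin n))), C ≠ 0 ∧ C ≠ ∞ ∧ IsGaussian Q ∧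
      P.withDensity (fun f => ENNReal.ofReal (∏ j ∈ s, t j (f j))) = C • Q ∧
      Var[fun f => f i; Q] ≠ 0 := by
  induction s using Finset.induction_on with
  | empty => exact ⟨1, P, by simp, by simp, inferInstance, by simp, hi⟩
  | insert k s hk ih =>
    obtain ⟨C, Q, hC0, hC, hQ, hPQ, hQi⟩ := ih fun j hj => ht j (Finset.mem_insert_of_mem hj)
    obtain ⟨m, v, hsite⟩ := ht k (Finset.mem_insert_self k s)
    obtain ⟨hv, Z, hZ0, hZ⟩ := id hsite
    have hinner : ∀ (j : Fin n) (f : EuclideanSpace ℝ (Fin n)),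
        inner ℝ (EuclideanSpace.basisFun (Fin n) ℝ j) f = f j := fun j f => by
      simp [PiLp.inner_apply]
    obtain ⟨D, R, hD0, hD, hR, hQR, hRi⟩ :=
      exists_isGaussian_withDensity Q (EuclideanSpace.basisFun (Fin n) ℝ k) m hv
    simp only [hinner] at hQR
    have hRi' := hRi (EuclideanSpace.basisFun (Fin n) ℝ i)
    simp only [hinner] at hRi'
    have hZ0' : ENNReal.ofReal Z ≠ 0 := by simpa using hZ0
    refine ⟨C * (ENNReal.ofReal Z * D), R, mul_ne_zero hC0 (mul_ne_zero hZ0' hD0),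
      ENNReal.mul_ne_top hC (ENNReal.mul_ne_top ENNReal.ofReal_ne_top hD), hR, ?_, hRi' hQi⟩
    have hmeas : Measurable fun f : EuclideanSpace ℝ (Fin n) =>
        ENNReal.ofReal (∏ j ∈ s, t j (f j)) := by
      refine ENNReal.measurable_ofReal.comp (Finset.measurable_fun_prod s fun j hj => ?_)
      obtain ⟨m', v', h'⟩ := ht j (Finset.mem_insert_of_mem hj)
      exact h'.measurable.comp (by fun_prop)
    have hmeas' : Measurable fun f : EuclideanSpace ℝ (Fin n) => gaussianPDF m v (f k) :=
      (measurable_gaussianPDF m v).comp (by fun_prop)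
    have hsplit : (fun f : EuclideanSpace ℝ (Fin n) =>
        ENNReal.ofReal (∏ j ∈ insert k s, t j (f j))) =
        (fun f => ENNReal.ofReal (∏ j ∈ s, t j (f j))) *
          (ENNReal.ofReal Z • fun f => gaussianPDF m v (f k)) := by
      ext f
      rw [Finset.prod_insert hk, mul_comm, ENNReal.ofReal_mul' (hsite.nonneg _), hZ,
        ENNReal.ofReal_mul hZ0.le]
      rfl
    rw [hsplit, withDensity_mul _ hmeas (hmeas'.const_smul _), hPQ, withDensity_smul_measure,
      withDensity_smul _ hmeas', hQR, smul_smul, smul_smul, mul_assoc]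

/-- The cavity distribution is a Gaussian measure, proportional to prior times sites, with a
nondegenerate Gaussian marginal at site `i`. -/
lemma exists_cavity_eq {n : ℕ} {K : Matrix (Fin n) (Fin n) ℝ} (hK : K.PosSemidef) {i : Fin n}
    (hKi : 0 < K i i) {t : Fin n → ℝ → ℝ}
    (ht : ∀ j : Fin n, j ≠ i → ∃ (m : ℝ) (v : ℝ≥0), IsGaussianSite (t j) m v) :
    ∃ (C : ℝ≥0∞) (a : ℝ) (u : ℝ≥0), C ≠ 0 ∧ C ≠ ∞ ∧ u ≠ 0 ∧
      (multivariateGaussian 0 K).withDensity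
        (fun f => ENNReal.ofReal (∏ j ∈ Finset.univ.erase i, t j (f j))) = C • cavity K t i ∧
      marginal (cavity K t i) i = gaussianReal a u := by
  obtain ⟨C, Q, hC0, hC, hQ, hPQ, hQi⟩ :=
    exists_isGaussian_withDensity_prod (multivariateGaussian 0 K) t i
      (by rw [variance_eval_multivariateGaussian hK]; exact hKi.ne') (Finset.univ.erase i)
      fun j hj => ht j (Finset.ne_of_mem_erase hj)
  have hcav : cavity K t i = Q := by
    rw [cavity, hPQ, normalize_smul _ hC0 hC, normalize_eq_self]
  refine ⟨C, ∫ f, f i ∂Q, (Var[fun f => f i; Q]).toNNReal, hC0, hC, ?_, by rw [hcav, hPQ], ?_⟩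
  · rw [Ne, Real.toNNReal_eq_zero, not_le]
    exact lt_of_le_of_ne (variance_nonneg _ _) (Ne.symm hQi)
  · rw [hcav]
    exact IsGaussian.map_eq_gaussianReal (μ := Q) (EuclideanSpace.proj i)

/-- After the update of site `i`, the marginal of the approximate posterior is the projected
Gaussian. -/
lemma marginal_approxPosterior_update {n : ℕ} {K : Matrix (Fin n) (Fin n) ℝ}
    (hK : K.PosSemidef) {i : Fin n} (hKi : 0 < K i i) {t : Fin n → ℝ → ℝ}
    (ht : ∀ j : Fin n, j ≠ i → ∃ (m : ℝ) (v : ℝ≥0), IsGaussianSite (t j) m v)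
    {m : ℝ} {v : ℝ≥0} (hv : v ≠ 0) {t' : ℝ → ℝ}
    (ht' : IsSiteUpdate (marginal (cavity K t i) i) m v t') :
    marginal (approxPosterior K (Function.update t i t')) i = gaussianReal m v := by
  obtain ⟨C, a, u, hC0, hC, hu, hcav, hmarg⟩ := exists_cavity_eq hK hKi ht
  obtain ⟨k, hk, hkt⟩ := ht'
  rw [hmarg, integral_id_gaussianReal, variance_id_gaussianReal, Real.toNNReal_coe] at hkt
  have ht'm : Measurable t' := by rw [funext hkt]; fun_prop
  have ht'0 : ∀ x, 0 ≤ t' x := fun x => by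
    rw [hkt]
    exact mul_nonneg hk.le
      (div_nonneg (gaussianPDFReal_nonneg m v x) (gaussianPDFReal_nonneg a u x))
  have hsplit : (fun f : EuclideanSpace ℝ (Fin n) =>
      ENNReal.ofReal (∏ j, Function.update t i t' j (f j))) =
      (fun f => ENNReal.ofReal (∏ j ∈ Finset.univ.erase i, t j (f j))) *
        (fun f => ENNReal.ofReal (t' (f i))) := by
    ext f
    rw [← Finset.mul_prod_erase _ _ (Finset.mem_univ i), Function.update_self, mul_comm,
      ENNReal.ofReal_mul' (ht'0 _), Pi.mul_apply]
    congr 2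
    refine Finset.prod_congr rfl fun j hj => ?_
    rw [Function.update_of_ne (Finset.ne_of_mem_erase hj)]
  have hmeas : Measurable fun f : EuclideanSpace ℝ (Fin n) =>
      ENNReal.ofReal (∏ j ∈ Finset.univ.erase i, t j (f j)) := by
    refine ENNReal.measurable_ofReal.comp (Finset.measurable_fun_prod _ fun j hj => ?_)
    obtain ⟨m', v', h'⟩ := ht j (Finset.ne_of_mem_erase hj)
    exact h'.measurable.comp (by fun_prop)
  have hi : Measurable fun f : EuclideanSpace ℝ (Fin n) => f i := by fun_prop
  have hmap := map_withDensity_comp (cavity K t i) hi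
    (ENNReal.measurable_ofReal.comp ht'm)
  simp only [Function.comp_apply] at hmap
  rw [marginal, approxPosterior, hsplit, withDensity_mul _ hmeas (by fun_prop), hcav,
    withDensity_smul_measure, normalize_smul _ hC0 hC, map_normalize _ hi, hmap]
  rw [marginal] at hmarg
  have hfun : (ENNReal.ofReal ∘ t') =
      fun x => ENNReal.ofReal (k * (gaussianPDFReal m v x / gaussianPDFReal a u x)) :=
    funext fun x => congrArg ENNReal.ofReal (hkt x)
  rw [hmarg, hfun, gaussianReal_withDensity_div a m hu hv hk,
    normalize_smul _ (by simpa using hk) ENNReal.ofReal_ne_top, normalize_eq_self]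

/-! ### Variance bound for Wasserstein projections. -/

section Wasserstein

lemma memLp_fst_sub_snd {π : Measure (ℝ × ℝ)}
    (h : ∫⁻ p, ENNReal.ofReal (|p.1 - p.2| ^ 2) ∂π ≠ ∞) :
    MemLp (fun p : ℝ × ℝ => p.1 - p.2) 2 π := by
  rw [memLp_two_iff_integrable_sq (by fun_prop)]
  refine ⟨by fun_prop, ?_⟩
  rw [hasFiniteIntegral_iff_ofReal (Filter.Eventually.of_forall fun p => sq_nonneg _)]
  simpa only [sq_abs] using lt_top_iff_ne_top.2 h

lemma exists_coupling_of_wassersteinSq_ne_top {ξ ν : Measure ℝ} (h : wassersteinSq ξ ν ≠ ∞) :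
    ∃ π : Measure (ℝ × ℝ), π.map Prod.fst = ξ ∧ π.map Prod.snd = ν ∧
      ∫⁻ p, ENNReal.ofReal (|p.1 - p.2| ^ 2) ∂π ≠ ∞ := by
  by_contra! H
  exact h (iInf₂_eq_top.2 fun π hπ => H π hπ.1 hπ.2)

/-- The first coordinate is the difference, square integrable by finite cost, plus the Gaussian
coordinate. -/
lemma memLp_snd_and_fst_of_coupling {m : ℝ} {v : ℝ≥0} {π : Measure (ℝ × ℝ)}
    (h2 : π.map Prod.snd = gaussianReal m v)
    (h : ∫⁻ p, ENNReal.ofReal (|p.1 - p.2| ^ 2) ∂π ≠ ∞) :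
    MemLp (fun p : ℝ × ℝ => p.2) 2 π ∧ MemLp (fun p : ℝ × ℝ => p.1) 2 π := by
  have hz : MemLp (fun p : ℝ × ℝ => p.2) 2 π := by
    have := IsGaussian.memLp_two_id (μ := gaussianReal m v)
    rw [← h2, memLp_map_measure_iff aestronglyMeasurable_id measurable_snd.aemeasurable] at this
    exact this
  refine ⟨hz, ?_⟩
  convert (memLp_fst_sub_snd h).add hz using 1
  ext p
  simp

/-- Finite transport cost to a Gaussian forces a finite second moment. -/
lemma memLp_of_wassersteinSq_ne_top {ξ : Measure ℝ} {m : ℝ} {v : ℝ≥0}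
    (h : wassersteinSq ξ (gaussianReal m v) ≠ ∞) : MemLp id 2 ξ := by
  obtain ⟨π, h1, h2, hπ⟩ := exists_coupling_of_wassersteinSq_ne_top h
  rw [← h1, memLp_map_measure_iff aestronglyMeasurable_id measurable_fst.aemeasurable]
  exact (memLp_snd_and_fst_of_coupling h2 hπ).2

/-- Shrinking a Gaussian whose variance exceeds that of `ξ` by a factor `r`, and centering it at
the mean of `ξ`, lowers the transport cost by a fixed amount. -/
lemma wassersteinSq_shrink_add_le {ξ : Measure ℝ} [IsProbabilityMeasure ξ] (m : ℝ) (v : ℝ≥0)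
    {r : ℝ≥0} (hr0 : 0 < r) (hr1 : r < 1)
    (hv : Var[id; ξ] / r ≤ v) :
    wassersteinSq ξ (gaussianReal (∫ x, x ∂ξ) (r ^ 2 * v)) +
        ENNReal.ofReal ((1 - r) * (v - Var[id; ξ] / r)) ≤
      wassersteinSq ξ (gaussianReal m v) := by
  refine le_iInf₂ fun π hπ => ?_
  obtain ⟨h1, h2⟩ := hπ
  by_cases hcost : ∫⁻ p, ENNReal.ofReal (|p.1 - p.2| ^ 2) ∂π = ∞
  · rw [hcost]; exact le_top
  obtain ⟨hz, hx⟩ := memLp_snd_and_fst_of_coupling h2 hcost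
  have hprob : IsProbabilityMeasure π := by
    constructor
    have := congrArg (fun ρ : Measure ℝ => ρ univ) h1
    simpa [Measure.map_apply measurable_fst MeasurableSet.univ] using this
  set c : ℝ := ∫ x, x ∂ξ with hc
  have hr0' : (0 : ℝ) < r := by exact_mod_cast hr0
  have hr1' : (r : ℝ) < 1 := by exact_mod_cast hr1
  -- This affine map carries `N(m, v)` to `N(c, r²v)`, so `(x, g z)` couples `ξ` with the shrunk
  -- Gaussian.
  set g : ℝ → ℝ := fun z => c + r * (z - m) with hg
  have hgm : Measurable g := by fun_prop
  have hEx : ∫ p, p.1 ∂π = c := by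
    rw [hc, ← h1, integral_map measurable_fst.aemeasurable (by fun_prop)]
  have hEz : ∫ p, p.2 ∂π = m := by
    rw [← integral_id_gaussianReal (μ := m) (v := v), ← h2,
      integral_map measurable_snd.aemeasurable (by fun_prop)]
  have hVx : ∫ p, (p.1 - c) ^ 2 ∂π = Var[id; ξ] := by
    rw [variance_eq_integral aemeasurable_id]
    simp only [id, ← hc]
    conv_rhs => rw [← h1]
    rw [integral_map measurable_fst.aemeasurable (by fun_prop)]
  have hVz : ∫ p, (p.2 - m) ^ 2 ∂π = v := by
    rw [← variance_id_gaussianReal (μ := m) (v := v), variance_eq_integral aemeasurable_id]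
    simp only [id, integral_id_gaussianReal]
    rw [← h2, integral_map measurable_snd.aemeasurable (by fun_prop)]
  have hxc : MemLp (fun p : ℝ × ℝ => p.1 - c) 2 π := hx.sub (memLp_const c)
  have hzm : MemLp (fun p : ℝ × ℝ => p.2 - m) 2 π := hz.sub (memLp_const m)
  have hxg : MemLp (fun p : ℝ × ℝ => p.1 - g p.2) 2 π := by
    convert hxc.sub (hzm.const_mul (r : ℝ)) using 1
    ext p
    simp only [hg, Pi.sub_apply]
    ring
  have hnew : wassersteinSq ξ (gaussianReal c (r ^ 2 * v)) ≤
      ENNReal.ofReal (∫ p, (p.1 - g p.2) ^ 2 ∂π) := by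
    have hmem : π.map (fun p => (p.1, g p.2)) ∈ {π : Measure (ℝ × ℝ) |
        π.map Prod.fst = ξ ∧ π.map Prod.snd = gaussianReal c (r ^ 2 * v)} := by
      constructor
      · rw [Measure.map_map measurable_fst (by fun_prop)]
        exact h1
      · rw [Measure.map_map measurable_snd (by fun_prop)]
        have : (Prod.snd ∘ fun p : ℝ × ℝ => (p.1, g p.2)) = g ∘ Prod.snd := rfl
        rw [this, ← Measure.map_map hgm measurable_snd, h2]
        have : g = (fun z => c + z) ∘ (fun z => (r : ℝ) * z) ∘ fun z => z - m := rfl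
        rw [this, ← Measure.map_map (by fun_prop) (by fun_prop),
          ← Measure.map_map (by fun_prop) (by fun_prop), gaussianReal_map_sub_const,
          gaussianReal_map_const_mul, gaussianReal_map_const_add]
        congr 1
        · ring
    refine (iInf₂_le _ hmem).trans ?_
    rw [lintegral_map (by fun_prop) (by fun_prop), ofReal_integral_eq_lintegral_ofReal
      hxg.integrable_sq (Filter.Eventually.of_forall fun p => sq_nonneg _)]
    simp [sq_abs]
  have hold : ∫⁻ p, ENNReal.ofReal (|p.1 - p.2| ^ 2) ∂π =
      ENNReal.ofReal (∫ p, (p.1 - p.2) ^ 2 ∂π) := by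
    rw [ofReal_integral_eq_lintegral_ofReal (memLp_fst_sub_snd hcost).integrable_sq
      (Filter.Eventually.of_forall fun p => sq_nonneg _)]
    simp [sq_abs]
  rw [hold]
  refine (add_le_add_left hnew _).trans ?_
  rw [← ENNReal.ofReal_add (integral_nonneg fun p => sq_nonneg _)
    (mul_nonneg (sub_nonneg.2 hr1'.le) (sub_nonneg.2 hv))]
  refine ENNReal.ofReal_le_ofReal ?_
  have i1 := hxg.integrable_sq
  have i2 := hxc.integrable_sq
  have i3 := hzm.integrable_sq
  have i4 := hxc.integrable one_le_two
  have i5 := hzm.integrable one_le_two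
  have i6 : Integrable (fun p : ℝ × ℝ =>
      (1 - (r : ℝ)) * ((p.2 - m) ^ 2 - (p.1 - c) ^ 2 / r)) π :=
    (i3.sub (i2.div_const _)).const_mul _
  have i7 : Integrable (fun p : ℝ × ℝ => 2 * (c - m) * ((p.1 - c) - (p.2 - m))) π :=
    (i4.sub i5).const_mul _
  have i8 : Integrable (fun p : ℝ × ℝ => (p.1 - g p.2) ^ 2 +
      (1 - (r : ℝ)) * ((p.2 - m) ^ 2 - (p.1 - c) ^ 2 / r)) π := i1.add i6
  -- The added linear term has mean zero; with it the comparison of costs holds pointwise.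
  have hsum : ∫ p, (p.1 - g p.2) ^ 2 ∂π + (1 - (r : ℝ)) * (v - Var[id; ξ] / r) =
      ∫ p, ((p.1 - g p.2) ^ 2 + (1 - (r : ℝ)) * ((p.2 - m) ^ 2 - (p.1 - c) ^ 2 / r) +
        2 * (c - m) * ((p.1 - c) - (p.2 - m))) ∂π := by
    rw [integral_add i8 i7, integral_add i1 i6, integral_const_mul, integral_const_mul,
      integral_sub i3 (i2.div_const _), integral_div, hVx, hVz, integral_sub i4 i5,
      integral_sub (hx.integrable one_le_two) (integrable_const _),
      integral_sub (hz.integrable one_le_two) (integrable_const _), hEx, hEz]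
    simp
  rw [hsum]
  refine integral_mono (i8.add i7) (memLp_fst_sub_snd hcost).integrable_sq fun p => ?_
  have h3 : 0 ≤ (1 - (r : ℝ)) / r * ((p.1 - c) - r * (p.2 - m)) ^ 2 :=
    mul_nonneg (div_nonneg (sub_nonneg.2 hr1'.le) hr0'.le) (sq_nonneg _)
  -- Young's inequality with weight `r` for the centred cross term, its defect written as an
  -- explicit square.
  have h4 : (p.1 - p.2) ^ 2 = (p.1 - g p.2) ^ 2 +
      (1 - (r : ℝ)) * ((p.2 - m) ^ 2 - (p.1 - c) ^ 2 / r) +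
      2 * (c - m) * ((p.1 - c) - (p.2 - m)) +
      ((1 - (r : ℝ)) / r * ((p.1 - c) - r * (p.2 - m)) ^ 2 + (c - m) ^ 2) := by
    simp only [hg]
    field_simp
    ring
  simp only
  linarith [sq_nonneg (c - m)]

/-- The variance of a Wasserstein projection onto the Gaussians is at most that of the projected
distribution. -/
lemma IsW2Projection.le_variance {ξ : Measure ℝ} [IsProbabilityMeasure ξ] {m : ℝ} {v : ℝ≥0}
    (h : IsW2Projection ξ m v) : (v : ℝ) ≤ Var[id; ξ] := by
  obtain ⟨hv, hfin, hmin⟩ := h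
  by_contra! hlt
  have hv0 : (0 : ℝ) < v := by exact_mod_cast pos_iff_ne_zero.mpr hv
  have hV := variance_nonneg id ξ
  have hq : Var[id; ξ] / v < 1 := (div_lt_one hv0).2 hlt
  have hq0 : 0 ≤ Var[id; ξ] / v := by positivity
  -- The midpoint of `V / v` and `1`: above `V / v` to make the drop strict, below `1` to shrink,
  -- and positive even if `V = 0`, so that the competitor has positive variance.
  set r : ℝ≥0 := ⟨(Var[id; ξ] / v + 1) / 2, by positivity⟩ with hr
  have hrc : (r : ℝ) = (Var[id; ξ] / v + 1) / 2 := rfl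
  have hr0 : (0 : ℝ) < r := by rw [hrc]; positivity
  have hr1 : (r : ℝ) < 1 := by rw [hrc]; linarith
  have hrV : Var[id; ξ] / r < v := by
    rw [div_lt_comm₀ hr0 hv0, hrc]
    linarith
  have hdrop := wassersteinSq_shrink_add_le (ξ := ξ) m v (by exact_mod_cast hr0)
    (by exact_mod_cast hr1) hrV.le
  have hr0' : r ≠ 0 := by exact_mod_cast hr0.ne'
  have hle := hmin (∫ x, x ∂ξ) (r ^ 2 * v) (mul_ne_zero (pow_ne_zero 2 hr0') hv)
  have hδ : ENNReal.ofReal ((1 - r) * (v - Var[id; ξ] / r)) ≠ 0 := by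
    simpa using mul_pos (sub_pos.2 hr1) (sub_pos.2 hrV)
  exact (ENNReal.lt_add_right hfin hδ).not_ge ((add_le_add_left hle _).trans hdrop)

end Wasserstein

/-! ### Moment matching for KL projections. -/

section KullbackLeibler

/-- Factoring through Lebesgue measure leaves the candidate Gaussian only in the second term, so the
entropy term cancels when two candidates are compared. -/
lemma llr_gaussianReal_ae_eq {ξ : Measure ℝ} [IsProbabilityMeasure ξ] (hξ : ξ ≪ volume) (m : ℝ)
    {v : ℝ≥0} (hv : v ≠ 0) :
    llr ξ (gaussianReal m v) =ᵐ[ξ] fun x =>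
      Real.log (ξ.rnDeriv volume x).toReal - Real.log (gaussianPDFReal m v x) := by
  rw [gaussianReal_of_var_ne_zero m hv]
  have h := Measure.rnDeriv_withDensity_right ξ volume
    (measurable_gaussianPDF m v).aemeasurable
    (Filter.Eventually.of_forall fun x => (gaussianPDF_pos m hv x).ne')
    (Filter.Eventually.of_forall fun x => gaussianPDF_ne_top)
  filter_upwards [hξ.ae_le h, Measure.rnDeriv_pos hξ,
    hξ.ae_le (Measure.rnDeriv_ne_top ξ volume)] with x hx hpos hfin
  rw [llr, hx, ENNReal.toReal_mul, ENNReal.toReal_inv, toReal_gaussianPDF,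
    Real.log_mul (inv_ne_zero (gaussianPDFReal_pos m v x hv).ne')
      (ENNReal.toReal_pos hpos.ne' hfin).ne', Real.log_inv]
  ring

lemma integrable_log_gaussianPDFReal {ξ : Measure ℝ} [IsProbabilityMeasure ξ]
    (h2 : MemLp id 2 ξ) (m : ℝ) {v : ℝ≥0} (hv : v ≠ 0) :
    Integrable (fun x => Real.log (gaussianPDFReal m v x)) ξ := by
  simp only [log_gaussianPDFReal m hv]
  exact (integrable_const _).sub ((h2.sub (memLp_const m)).integrable_sq.div_const _)

lemma integral_sub_sq {ξ : Measure ℝ} [IsProbabilityMeasure ξ] (h2 : MemLp id 2 ξ) (m : ℝ) :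
    ∫ x, (x - m) ^ 2 ∂ξ = Var[id; ξ] + (∫ x, x ∂ξ - m) ^ 2 := by
  set c := ∫ x, x ∂ξ with hc
  have hx : Integrable (fun x : ℝ => x) ξ := h2.integrable one_le_two
  have hV : ∫ x, (x - c) ^ 2 ∂ξ = Var[id; ξ] := by
    rw [variance_eq_integral aemeasurable_id]
    rfl
  have i1 : Integrable (fun x => (x - c) ^ 2) ξ := (h2.sub (memLp_const c)).integrable_sq
  have i2 : Integrable (fun x => 2 * (c - m) * (x - c)) ξ :=
    (hx.sub (integrable_const c)).const_mul _
  have i3 : Integrable (fun x => (x - c) ^ 2 + 2 * (c - m) * (x - c)) ξ := i1.add i2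
  have : (fun x => (x - m) ^ 2) = fun x =>
      ((x - c) ^ 2 + 2 * (c - m) * (x - c)) + (c - m) ^ 2 := by
    ext x; ring
  rw [this, integral_add i3 (integrable_const _), integral_add i1 i2, hV,
    integral_const_mul, integral_sub hx (integrable_const _), ← hc]
  simp

lemma integral_log_gaussianPDFReal {ξ : Measure ℝ} [IsProbabilityMeasure ξ]
    (h2 : MemLp id 2 ξ) (m : ℝ) {v : ℝ≥0} (hv : v ≠ 0) :
    ∫ x, Real.log (gaussianPDFReal m v x) ∂ξ = -(Real.log (2 * Real.pi) / 2) - Real.log v / 2 -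
      (Var[id; ξ] + (∫ x, x ∂ξ - m) ^ 2) / (2 * v) := by
  have hsq : Integrable (fun x : ℝ => (x - m) ^ 2) ξ := (h2.sub (memLp_const m)).integrable_sq
  simp only [log_gaussianPDFReal m hv]
  rw [integral_sub (integrable_const _) (hsq.div_const _), integral_div, integral_sub_sq h2]
  simp

/-- An absolutely continuous law has no atoms, so it is not almost surely constant. This makes the
moment-matched Gaussian an admissible competitor. -/
lemma variance_id_pos_of_absolutelyContinuous {ξ : Measure ℝ} [IsProbabilityMeasure ξ]
    (hξ : ξ ≪ volume) (h2 : MemLp id 2 ξ) : 0 < Var[id; ξ] := by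
  refine lt_of_le_of_ne (variance_nonneg _ _) fun h => ?_
  have h0 : evariance id ξ = 0 := by
    rw [← h2.ofReal_variance_eq, ← h, ENNReal.ofReal_zero]
  have h1 := (evariance_eq_zero_iff aemeasurable_id).1 h0
  have h3 : ∀ᵐ x ∂ξ, x ≠ ∫ x, id x ∂ξ :=
    hξ.ae_le (compl_mem_ae_iff.2 (measure_singleton _))
  obtain ⟨x, hx1, hx2⟩ := (h1.and h3).exists
  exact hx2 hx1

/-- Moment matching: the variance of a Kullback–Leibler projection onto the Gaussians is that of
the projected distribution. -/
lemma IsKLProjection.variance_eq {ξ : Measure ℝ} [IsProbabilityMeasure ξ] (hξ : ξ ≪ volume)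
    (h2 : MemLp id 2 ξ) {m : ℝ} {v : ℝ≥0} (h : IsKLProjection ξ m v) :
    (v : ℝ) = Var[id; ξ] := by
  obtain ⟨hv, hfin, hmin⟩ := h
  have hv0 : (0 : ℝ) < v := by exact_mod_cast pos_iff_ne_zero.mpr hv
  have hV := variance_id_pos_of_absolutelyContinuous hξ h2
  set s : ℝ≥0 := (Var[id; ξ]).toNNReal with hs
  have hs0 : s ≠ 0 := by simpa [hs] using hV
  have hsV : (s : ℝ) = Var[id; ξ] := Real.coe_toNNReal _ hV.le
  set c := ∫ x, x ∂ξ with hc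
  obtain ⟨hac, hint⟩ := InformationTheory.klDiv_ne_top_iff.1 hfin
  have hac' : ξ ≪ gaussianReal c s := hξ.trans (gaussianReal_absolutelyContinuous' c hs0)
  have e1 := llr_gaussianReal_ae_eq hξ m hv
  have e2 := llr_gaussianReal_ae_eq hξ c hs0
  have j1 := integrable_log_gaussianPDFReal h2 m hv
  have j2 := integrable_log_gaussianPDFReal h2 c hs0
  -- Integrability of the log-density is recovered from the finite divergence at the minimizer, then
  -- reused to make the divergence of the competitor finite.
  have j0 : Integrable (fun x => Real.log (ξ.rnDeriv volume x).toReal) ξ := by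
    refine (((integrable_congr e1).1 hint).add j1).congr (Filter.Eventually.of_forall fun x => ?_)
    simp
  have hint' : Integrable (llr ξ (gaussianReal c s)) ξ :=
    (integrable_congr e2).2 (j0.sub j2)
  have hle := (ENNReal.toReal_le_toReal hfin
    (InformationTheory.klDiv_ne_top hac' hint')).2 (hmin c s hs0)
  rw [InformationTheory.toReal_klDiv_of_measure_eq hac (by simp),
    InformationTheory.toReal_klDiv_of_measure_eq hac' (by simp), integral_congr_ae e1,
    integral_congr_ae e2, integral_sub j0 j1, integral_sub j0 j2,
    integral_log_gaussianPDFReal h2 m hv, integral_log_gaussianPDFReal h2 c hs0, ← hc, sub_self,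
    hsV] at hle
  by_contra hne
  have hu : 0 < Var[id; ξ] / v := div_pos hV hv0
  have hu1 : Var[id; ξ] / v ≠ 1 := fun h => hne ((div_eq_one_iff_eq hv0.ne').1 h).symm
  -- The divergence gap to the moment-matched Gaussian is `(V/v - 1 - log (V/v)) / 2 + (c - m)² /
  -- (2v)`, strictly positive unless `V = v`.
  have hlog := Real.log_lt_sub_one_of_pos hu hu1
  rw [Real.log_div hV.ne' hv0.ne'] at hlog
  have hd1 : (Var[id; ξ] + 0 ^ 2) / (2 * Var[id; ξ]) = 1 / 2 := by field_simp; simp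
  have hd2 : (Var[id; ξ] + (c - m) ^ 2) / (2 * (v : ℝ)) =
      Var[id; ξ] / v / 2 + (c - m) ^ 2 / (2 * v) := by field_simp
  have hd3 : 0 ≤ (c - m) ^ 2 / (2 * (v : ℝ)) := by positivity
  rw [hd1, hd2] at hle
  linarith

end KullbackLeibler

end GPApprox

/-! ### Comparison of the two updates. -/

theorem corollary1 {n : ℕ}
    -- prior covariance, site `i` to be updated, current Gaussian sites, likelihood of `y_i`
    (K : Matrix (Fin n) (Fin n) ℝ) (hK : K.PosSemidef) (i : Fin n) (hKi : 0 < K i i)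
    (t : Fin n → ℝ → ℝ)
    (ht : ∀ j : Fin n, j ≠ i → ∃ (m : ℝ) (v : ℝ≥0), GPApprox.IsGaussianSite (t j) m v)
    (l : ℝ → ℝ) (hl_meas : Measurable l) (hl_nonneg : ∀ f : ℝ, 0 ≤ l f)
    -- the tilted distribution is normalizable
    (hZ_pos : ∫⁻ f, ENNReal.ofReal (l f)
      ∂(GPApprox.marginal (GPApprox.cavity K t i) i) ≠ 0)
    (hZ_fin : ∫⁻ f, ENNReal.ofReal (l f)
      ∂(GPApprox.marginal (GPApprox.cavity K t i) i) ≠ ∞)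
    -- EP and QP projections of the same tilted distribution
    (mEP mQP : ℝ) (vEP vQP : ℝ≥0)
    (hEP : GPApprox.IsKLProjection
      (GPApprox.tilted (GPApprox.marginal (GPApprox.cavity K t i) i) l) mEP vEP)
    (hQP : GPApprox.IsW2Projection
      (GPApprox.tilted (GPApprox.marginal (GPApprox.cavity K t i) i) l) mQP vQP)
    -- the site functions updated by EP and by QP
    (tEP tQP : ℝ → ℝ)
    (htEP : GPApprox.IsSiteUpdate
      (GPApprox.marginal (GPApprox.cavity K t i) i) mEP vEP tEP)
    (htQP : GPApprox.IsSiteUpdate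
      (GPApprox.marginal (GPApprox.cavity K t i) i) mQP vQP tQP) :
    -- site variances
    (∀ (m : ℝ) (sEP : ℝ≥0), GPApprox.IsGaussianSite tEP m sEP →
      (∃ (m' : ℝ) (sQP : ℝ≥0), GPApprox.IsGaussianSite tQP m' sQP) ∧
      ∀ (m' : ℝ) (sQP : ℝ≥0), GPApprox.IsGaussianSite tQP m' sQP → sQP ≤ sEP) ∧
    -- variances of the marginals of the approximate posteriors after the update of site `i`
    (∃ (m m' : ℝ) (sEP sQP : ℝ≥0),
      GPApprox.marginal (GPApprox.approxPosterior K (Function.update t i tEP)) i =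
        gaussianReal m sEP ∧
      GPApprox.marginal (GPApprox.approxPosterior K (Function.update t i tQP)) i =
        gaussianReal m' sQP ∧
      sQP ≤ sEP) := by
  obtain ⟨C, a, u, -, -, hu, -, hmarg⟩ := GPApprox.exists_cavity_eq hK hKi ht
  have hmargEP := GPApprox.marginal_approxPosterior_update hK hKi ht hEP.1 htEP
  have hmargQP := GPApprox.marginal_approxPosterior_update hK hKi ht hQP.1 htQP
  rw [hmarg] at hZ_pos hZ_fin hEP hQP htEP htQP
  -- the tilted distribution
  set ξ := GPApprox.tilted (gaussianReal a u) l with hξ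
  have hprob : IsProbabilityMeasure ξ :=
    GPApprox.isProbabilityMeasure_normalize (by simpa using hZ_pos) (by simpa using hZ_fin)
  have hac : ξ ≪ volume :=
    (GPApprox.normalize_absolutelyContinuous _).trans
      ((withDensity_absolutelyContinuous _ _).trans (gaussianReal_absolutelyContinuous a hu))
  have hvar : vQP ≤ vEP := by
    -- The second moment needed for KL moment matching comes from the finite Wasserstein minimum.
    have h2 := GPApprox.memLp_of_wassersteinSq_ne_top hQP.2.1
    exact_mod_cast hQP.le_variance.trans (hEP.variance_eq hac h2).ge
  refine ⟨?_, mEP, mQP, vEP, vQP, hmargEP, hmargQP, hvar⟩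
  obtain ⟨kE, hkE, htE⟩ := htEP
  obtain ⟨kQ, hkQ, htQ⟩ := htQP
  rw [integral_id_gaussianReal, variance_id_gaussianReal, Real.toNNReal_coe] at htE htQ
  have hEiff := GPApprox.isGaussianSite_update_iff hu hEP.1 hkE htE
  have hQiff := GPApprox.isGaussianSite_update_iff hu hQP.1 hkQ htQ
  have hQ0 : (0 : ℝ) < vQP := by exact_mod_cast pos_iff_ne_zero.mpr hQP.1
  have hinv : (vEP : ℝ)⁻¹ ≤ (vQP : ℝ)⁻¹ := inv_anti₀ hQ0 (by exact_mod_cast hvar)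
  intro m sEP hsE
  obtain ⟨hsE0, hsE'⟩ := (hEiff sEP).1 ⟨m, hsE⟩
  have hsEpos : (0 : ℝ) < sEP := by exact_mod_cast pos_iff_ne_zero.mpr hsE0
  -- The QP site precision is at least the EP one, which is positive because the EP site is
  -- Gaussian.
  have hprec : 0 < (vQP : ℝ)⁻¹ - (u : ℝ)⁻¹ := by linarith [inv_pos.2 hsEpos]
  constructor
  · obtain ⟨b, hb⟩ := (hQiff ((vQP : ℝ)⁻¹ - (u : ℝ)⁻¹)⁻¹.toNNReal).2
      ⟨by simpa using hprec, by rw [Real.coe_toNNReal _ (inv_pos.2 hprec).le, inv_inv]⟩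
    exact ⟨b, _, hb⟩
  · intro m' sQP hsQ
    obtain ⟨hsQ0, hsQ'⟩ := (hQiff sQP).1 ⟨m', hsQ⟩
    have hsQpos : (0 : ℝ) < sQP := by exact_mod_cast pos_iff_ne_zero.mpr hsQ0
    have : (sQP : ℝ) ≤ sEP := by
      rw [← inv_le_inv₀ hsEpos hsQpos, hsE', hsQ']
      linarith
    exact_mod_cast this
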